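/- Let $d\in\{1,2,3\}$, $L>0$, $\Omega=[-L,L]^d$, and let $H^m_p(\Omega)$ ($m\in\mathbb N$) be the $2L$-periodic Sobolev space, i.e. the space of $f\in L^2(\Omega)$ (complex valued) all of whose weak derivatives of order at most $m$, tested against smooth $2L$-periodic functions, lie in $L^2(\Omega)$. Let $\mathbf S_x=\frac1{\sqrt2}\begin{bmatrix}0&1&0\\1&0&1\\0&1&0\end{bmatrix}$, $\mathbf S_y=\frac{\mathrm i}{\sqrt2}\begin{bmatrix}0&-1&0\\1&0&-1\\0&1&0\end{bmatrix}$, $\mathbf S_z=\mathrm{diag}(1,0,-1)$ be the spin-1 matrices, let $\beta_n,\beta_s\in\mathbb R$, $\Lambda=\mathrm{diag}(\mu_1,\mu_0,\mu_{-1})$ with real $\mu_j$, let $V$ be a real potential and $\Phi=(\phi_1,\phi_0,\phi_{-1})^\top$ a $\mathbb C^3$-valued function (such as the ground state of a spin-1 condensate, the $\mu_j$ being its chemical potentials), both bounded on $\Omega$. With $\rho=|\phi_1|^2+|\phi_0|^2+|\phi_{-1}|^2$ define the Bogoliubov--de Gennes operators $$\mathcal A=\big(-\tfrac12\nabla^2+V\big)\mathbf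 I_3-\Lambda+\beta_n\big(\rho\,\mathbf I_3+\Phi\Phi^{\mathsf H}\big)+\beta_s\sum_{j=x,y,z}\Big((\Phi^{\mathsf H}\mathbf S_j\Phi)\,\mathbf S_j+\mathbf S_j\Phi\Phi^{\mathsf H}\mathbf S_j^{\mathsf H}\Big),$$ $$\mathcal B=\beta_n\Phi\Phi^\top+\beta_s\sum_{j=x,y,z}\mathbf S_j\Phi\Phi^\top\mathbf S_j^\top .$$ For an even integer $N>0$ and a continuous $2L$-periodic function $F$ let $$(\mathcal I_NF)(x)=\sum_{k}\widetilde F_k W_k(x),\qquad \widetilde F_k=\frac1{N^d}\sum_{n\in\{0,\dots,N-1\}^d}F(x_n)\overline{W_k(x_n)},$$ where $k$ runs over $\{-N/2,\dots,N/2-1\}^d$, $W_k(x)=\prod_{i=1}^d e^{\mathrm i\pi k_i(x_i+L)/L}$ and $x_n=\big(-L+2Ln_i/N\big)_{i=1}^d$; on vector functions $\mathcal I_N$ acts componentwise. Let $m\in\mathbb N$ with $m>d/2+2$ and $\boldsymbol\chi=(\chi_1,\chi_0,\chi_{-1})^\top\in(H^m_p(\Omega))^3$. Then $\boldsymbol\chi$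 agrees almost everywhere on $\Omega$ with a $2L$-periodic function of class $C^2$, with which it is identified, and for $\mathcal Q=\mathcal A$ and for $\mathcal Q=\mathcal B$ there is a constant $c>0$, independent of $N$, such that for every even integer $N>0$ $$\|\mathcal Q\boldsymbol\chi-\mathcal Q(\mathcal I_N\boldsymbol\chi)\|_\infty\le c\,N^{-(m-\frac d2-2)},$$ where $\|\boldsymbol f\|_\infty=\max_j\sup_{x\in\Omega}|f_j(x)|$. -/

import Mathlib

open MeasureTheory
open scoped ENNReal Matrix ContDiff

noncomputable section

namespace SpinBdG

/-- The physical space `ℝ^d` with its Euclidean structure. -/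
abbrev Space (d : ℕ) : Type := EuclideanSpace ℝ (Fin d)

/-- The computational domain `Ω = [-L, L]^d`. -/
def box (d : ℕ) (L : ℝ) : Set (Space d) := {x | ∀ i, x i ∈ Set.Icc (-L) L}

/-- `f` is `2L`-periodic in each coordinate. -/
def IsPeriodic {d : ℕ} (L : ℝ) (f : Space d → ℂ) : Prop :=
  ∀ (i : Fin d) (x : Space d), f (x + EuclideanSpace.single i (2 * L)) = f x

/-- The classical partial derivative `∂f/∂x_i`. -/
def partialDeriv {d : ℕ} (i : Fin d) (f : Space d → ℂ) : Space d → ℂ :=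
  fun x => fderiv ℝ f x (EuclideanSpace.single i 1)

/-- `∂^α f = ∂_1^{α_1} ⋯ ∂_d^{α_d} f` for a multi-index `α`. -/
def multiDeriv {d : ℕ} (α : Fin d → ℕ) (f : Space d → ℂ) : Space d → ℂ :=
  (List.finRange d).foldr (fun i g => (partialDeriv i)^[α i] g) f

/-- `g` is the weak derivative `∂^α f` on `Ω` with periodic boundary conditions:
it is tested against all smooth `2L`-periodic functions. -/
def IsPeriodicWeakDeriv {d : ℕ} (L : ℝ) (α : Fin d → ℕ) (f g : Space d → ℂ) : Prop :=
  ∀ φ : Space d → ℂ, ContDiff ℝ ∞ φ → IsPeriodic L φ →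
    ∫ x in box d L, f x * multiDeriv α φ x =
      (-1 : ℂ) ^ (∑ i, α i) * ∫ x in box d L, g x * φ x

/-- Membership in the `2L`-periodic Sobolev space `H_p^m(Ω)`: `f ∈ L²(Ω)` has periodic weak
derivatives of every order `|α| ≤ m` in `L²(Ω)`. Only the class of `f` modulo null sets
of `Ω` matters. -/
def MemPeriodicSobolev {d : ℕ} (L : ℝ) (m : ℕ) (f : Space d → ℂ) : Prop :=
  MemLp f 2 (volume.restrict (box d L)) ∧
    ∀ α : Fin d → ℕ, ∑ i, α i ≤ m →
      ∃ g : Space d → ℂ, MemLp g 2 (volume.restrict (box d L)) ∧ IsPeriodicWeakDeriv L α f g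

/-- The plane wave `W_k(x) = ∏_i exp(i π k_i (x_i + L) / L)`. -/
def planeWave {d : ℕ} (L : ℝ) (k : Fin d → ℤ) (x : Space d) : ℂ :=
  ∏ i, Complex.exp (Complex.I * ((Real.pi * k i / L * (x i + L) : ℝ) : ℂ))

/-- The grid point `x_n = (-L + n_i h)_i` with mesh size `h = 2L/N`. -/
def gridPoint {d : ℕ} (L : ℝ) (N : ℕ) (n : Fin d → Fin N) : Space d :=
  WithLp.toLp 2 fun i => -L + ((n i : ℕ) : ℝ) * (2 * L / N)

/-- The discrete Fourier coefficient `F̃_k = N^{-d} ∑_n F(x_n) conj (W_k(x_n))`. -/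
def discreteFourierCoeff {d : ℕ} (L : ℝ) (N : ℕ) (F : Space d → ℂ) (k : Fin d → ℤ) : ℂ :=
  1 / (N : ℂ) ^ d *
    ∑ n : Fin d → Fin N, F (gridPoint L N n) * star (planeWave L k (gridPoint L N n))

/-- The frequencies `k` with `-N/2 ≤ k_i ≤ N/2 - 1` (used for even `N`). -/
def frequencies (d N : ℕ) : Finset (Fin d → ℤ) :=
  Fintype.piFinset fun _ => Finset.Ico (-((N / 2 : ℕ) : ℤ)) ((N / 2 : ℕ) : ℤ)

/-- The Fourier pseudo-spectral interpolant `I_N F = ∑_k F̃_k W_k`. -/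
def interpolant {d : ℕ} (L : ℝ) (N : ℕ) (F : Space d → ℂ) : Space d → ℂ :=
  fun x => ∑ k ∈ frequencies d N, discreteFourierCoeff L N F k * planeWave L k x

/-- The componentwise interpolant of a three-component function. -/
def vecInterpolant {d : ℕ} (L : ℝ) (N : ℕ) (χ : Space d → Fin 3 → ℂ) : Space d → Fin 3 → ℂ :=
  fun x j => interpolant L N (fun y => χ y j) x

/-- `‖χ‖_∞ = max_j sup_{x ∈ Ω} |χ_j(x)|`, as an extended nonnegative real. -/
def supNorm {d : ℕ} (L : ℝ) (χ : Space d → Fin 3 → ℂ) : ℝ≥0∞ :=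
  ⨆ j : Fin 3, ⨆ x ∈ box d L, ‖χ x j‖ₑ

/-- The spin-1 matrices `S_x, S_y, S_z`. The indices `0, 1, 2 : Fin 3` of their rows and columns
stand for the spin components `1, 0, -1`. -/
def spinMatrix : Fin 3 → Matrix (Fin 3) (Fin 3) ℂ :=
  ![(1 / (Real.sqrt 2 : ℂ)) • !![0, 1, 0; 1, 0, 1; 0, 1, 0],
    (Complex.I / (Real.sqrt 2 : ℂ)) • !![0, -1, 0; 1, 0, -1; 0, 1, 0],
    !![1, 0, 0; 0, 0, 0; 0, 0, -1]]

/-- The density `ρ = |φ_1|² + |φ_0|² + |φ_{-1}|²`. -/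
def density (φ : Fin 3 → ℂ) : ℝ := ∑ j, ‖φ j‖ ^ 2

/-- The spin vector `s_j(φ) = φ^H S_j φ`. -/
def spinVector (φ : Fin 3 → ℂ) (j : Fin 3) : ℂ := star φ ⬝ᵥ (spinMatrix j *ᵥ φ)

/-- `β_n (ρ I + φ φ^H) + β_s (S·s(φ) + ∑_j S_j φ φ^H S_j^H)`. -/
def coeffA (βn βs : ℝ) (φ : Fin 3 → ℂ) : Matrix (Fin 3) (Fin 3) ℂ :=
  (βn : ℂ) • ((density φ : ℂ) • (1 : Matrix (Fin 3) (Fin 3) ℂ) + Matrix.vecMulVec φ (star φ)) +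
    (βs : ℂ) • (∑ j, spinVector φ j • spinMatrix j +
      ∑ j, spinMatrix j * Matrix.vecMulVec φ (star φ) * (spinMatrix j)ᴴ)

/-- `β_n φ φ^T + β_s ∑_j S_j φ φ^T S_j^T`. -/
def coeffB (βn βs : ℝ) (φ : Fin 3 → ℂ) : Matrix (Fin 3) (Fin 3) ℂ :=
  (βn : ℂ) • Matrix.vecMulVec φ φ +
    (βs : ℂ) • ∑ j, spinMatrix j * Matrix.vecMulVec φ φ * (spinMatrix j)ᵀ

/-- The operator `𝒜 = (-½∇² + V) I - diag(μ) + coeffA(Φ)`. -/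
def opA {d : ℕ} (V : Space d → ℝ) (μ : Fin 3 → ℝ) (βn βs : ℝ) (Φ : Space d → Fin 3 → ℂ)
    (χ : Space d → Fin 3 → ℂ) : Space d → Fin 3 → ℂ :=
  fun x j =>
    -(1 / 2 : ℂ) * Laplacian.laplacian (fun y => χ y j) x + (V x : ℂ) * χ x j - (μ j : ℂ) * χ x j
      + (coeffA βn βs (Φ x) *ᵥ χ x) j

/-- The operator `ℬ` of multiplication by `coeffB(Φ)`. -/
def opB {d : ℕ} (βn βs : ℝ) (Φ : Space d → Fin 3 → ℂ)
    (χ : Space d → Fin 3 → ℂ) : Space d → Fin 3 → ℂ :=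
  fun x => coeffB βn βs (Φ x) *ᵥ χ x

end SpinBdG

end

/-! Expand a component of `χ` in its Fourier series `∑ a_k W_k` on `Ω`. Testing the weak derivatives
against plane waves gives `∑ ‖k‖^(2m) |a_k|² < ∞` (`summable_sobolev_weight`). Since `2(m - 2) > d`,
Cauchy-Schwarz against `‖k‖^(-(m-2))` bounds the tail of `∑ ‖k‖² |a_k|` over `‖k‖ ≥ M` by `O(M^(-(m
- d/2 - 2)))` (`exists_tail_weighted_le`). In particular the series may be differentiated twice
termwise, and its sum is the periodic `C²` representative `F`.

On the grid `W_k` coincides with `W_k'`, where `k'` is the representative of `k` modulo `N` in the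
frequency box. Hence `F - I_N F = ∑ a_k (W_k - W_k')` (`hasSum_interpolant`). Terms with `‖k‖ < N/2`
vanish, and the others have derivatives of order at most two of size `O(‖k‖² |a_k|)`, so the tail
bound controls the error and its Laplacian uniformly. Both operators are linear, of order at most
two, with coefficients bounded on `Ω`, and so inherit the rate. -/

noncomputable section

namespace SpinBdG

/-! ### Transfer of Fourier series from the unit torus to the box -/

section Torus

-- With the Haar probability measure as volume, the monomials `mFourier` are orthonormal in `L²` of
-- the torus.
local instance : MeasureSpace UnitAddCircle := ⟨AddCircle.haarAddCircle⟩

local instance : Measure.IsAddHaarMeasure (volume : Measure UnitAddCircle) :=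
  inferInstanceAs (Measure.IsAddHaarMeasure AddCircle.haarAddCircle)

local instance : IsProbabilityMeasure (volume : Measure UnitAddCircle) :=
  inferInstanceAs (IsProbabilityMeasure AddCircle.haarAddCircle)

variable {d : ℕ} {L : ℝ}

/-- The quotient map from `ℝ` to the circle `ℝ / 2Lℤ`, rescaled to unit length. -/
def toCircle (L : ℝ) (t : ℝ) : UnitAddCircle := (((t + L) / (2 * L) : ℝ) : UnitAddCircle)

/-- The quotient map from `ℝ^d` to the rescaled torus. -/
def toTorus (L : ℝ) (x : Space d) : UnitAddTorus (Fin d) := fun i => toCircle L (x i)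

/-- The section of `toTorus` with values in `(-L, L]^d`. -/
def ofTorus (L : ℝ) (t : UnitAddTorus (Fin d)) : Space d :=
  WithLp.toLp 2 fun i => 2 * L * (AddCircle.equivIoc 1 0 (t i) : ℝ) - L

/-- The normalized Lebesgue measure on `Ω`. -/
def boxMeasure (d : ℕ) (L : ℝ) : Measure (Space d) :=
  (ENNReal.ofReal (2 * L)⁻¹) ^ d • volume.restrict (box d L)

theorem measurable_toCircle (L : ℝ) : Measurable (toCircle L) :=
  AddCircle.measurable_mk'.comp (by fun_prop)

theorem measurable_toTorus (L : ℝ) : Measurable (toTorus L : Space d → _) :=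
  measurable_pi_lambda _ fun i => (measurable_toCircle L).comp (by fun_prop)

theorem measurable_ofTorus (L : ℝ) : Measurable (ofTorus L : _ → Space d) := by
  refine (WithLp.measurable_toLp 2 _).comp (measurable_pi_lambda _ fun i => ?_)
  have h : Measurable fun s : UnitAddCircle => (AddCircle.equivIoc 1 0 s : ℝ) :=
    measurable_subtype_coe.comp (AddCircle.measurableEquivIoc (1 : ℝ) 0).measurable
  exact ((h.comp (measurable_pi_apply i)).const_mul _).sub_const _

theorem toTorus_ofTorus (hL : 0 < L) (t : UnitAddTorus (Fin d)) :
    toTorus L (ofTorus L t) = t := by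
  ext i
  have : (2 * L * (AddCircle.equivIoc 1 0 (t i) : ℝ) - L + L) / (2 * L) =
    (AddCircle.equivIoc (1 : ℝ) 0 (t i) : ℝ) := by field_simp; ring
  simp only [toTorus, toCircle, ofTorus, this]
  exact AddCircle.coe_equivIoc

theorem ofTorus_toTorus (hL : 0 < L) {x : Space d} (hx : ∀ i, x i ∈ Set.Ioc (-L) L) :
    ofTorus L (toTorus L x) = x := by
  ext i
  have h : (x i + L) / (2 * L) ∈ Set.Ioc (0 : ℝ) (0 + 1) := by
    have := hx i
    constructor
    · exact div_pos (by linarith [this.1]) (by linarith)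
    · rw [div_le_iff₀ (by linarith)]; linarith [this.2]
  simp only [ofTorus, toTorus, toCircle, AddCircle.equivIoc_coe_of_mem h]
  field_simp; ring

/-- An affine map carries normalized Lebesgue measure on `(-L, L]` to Lebesgue measure on `(0, 1]`,
which the quotient map carries to the circle. -/
theorem measurePreserving_toCircle (hL : 0 < L) :
    MeasurePreserving (toCircle L)
      (ENNReal.ofReal (2 * L)⁻¹ • volume.restrict (Set.Icc (-L) L)) volume := by
  have h1 : MeasurePreserving (fun t : ℝ => (t + L) / (2 * L))
      (ENNReal.ofReal (2 * L)⁻¹ • volume.restrict (Set.Ioc (-L) L))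
      (volume.restrict (Set.Ioc (0 : ℝ) (0 + 1))) := by
    have h2 : MeasurePreserving (fun t : ℝ => t / (2 * L))
        (ENNReal.ofReal (2 * L)⁻¹ • volume) volume := by
      refine ⟨by fun_prop, ?_⟩
      have := Real.smul_map_volume_mul_right (a := (2 * L)⁻¹) (by positivity)
      rw [abs_of_pos (by positivity)] at this
      simpa only [div_eq_mul_inv, Measure.map_smul] using this
    have h3 : MeasurePreserving (fun t : ℝ => t + L)
        (ENNReal.ofReal (2 * L)⁻¹ • volume) (ENNReal.ofReal (2 * L)⁻¹ • volume) :=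
      (measurePreserving_add_right volume L).smul_measure _
    have h4 := (h2.comp h3).restrict_preimage (s := Set.Ioc (0 : ℝ) (0 + 1)) measurableSet_Ioc
    rw [Measure.restrict_smul] at h4
    have h6 : ((fun t : ℝ => t / (2 * L)) ∘ fun t => t + L) ⁻¹' Set.Ioc (0 : ℝ) (0 + 1) =
        Set.Ioc (-L) L := by
      ext t
      simp only [Set.mem_Ioc, Set.mem_preimage, Function.comp_apply, zero_add]
      rw [div_le_iff₀ (by linarith), lt_div_iff₀ (by linarith)]
      constructor <;> intro h <;> constructor <;> linarith [h.1, h.2]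
    rwa [h6] at h4
  rw [← restrict_Ioc_eq_restrict_Icc]
  have h5 := (AddCircle.measurePreserving_mk (1 : ℝ) 0).comp h1
  refine ⟨measurable_toCircle L, ?_⟩
  have := h5.map_eq
  -- The quotient map was measured with the standard volume of the circle; for period 1 this is the
  -- Haar probability measure.
  rw [AddCircle.volume_eq_smul_haarAddCircle] at this
  rw [ENNReal.ofReal_one, one_smul] at this
  exact this

theorem pi_smul_measure (c : ℝ≥0∞) (hc : c ≠ ⊤) (μ : Measure ℝ) [IsFiniteMeasure μ] :
    Measure.pi (fun _ : Fin d => c • μ) = c ^ d • Measure.pi fun _ : Fin d => μ := by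
  have : IsFiniteMeasure (c • μ) := Measure.smul_finite μ hc
  refine Measure.pi_eq fun s _ => ?_
  simp [Measure.pi_pi, Finset.prod_mul_distrib]

theorem measurePreserving_toTorus (hL : 0 < L) :
    MeasurePreserving (toTorus L) (boxMeasure d L) volume := by
  have h1 : MeasurePreserving (fun (x : Fin d → ℝ) i => toCircle L (x i)) _ volume :=
    measurePreserving_pi _ _ fun _ => measurePreserving_toCircle hL
  rw [pi_smul_measure _ ENNReal.ofReal_ne_top] at h1
  have h2 : MeasurePreserving (WithLp.ofLp : Space d → Fin d → ℝ) (boxMeasure d L)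
      ((ENNReal.ofReal (2 * L)⁻¹) ^ d •
        Measure.pi fun _ : Fin d => volume.restrict (Set.Icc (-L) L)) := by
    refine MeasurePreserving.smul_measure ?_ _
    rw [← Measure.restrict_pi_pi]
    have := (PiLp.volume_preserving_ofLp (Fin d)).restrict_preimage
      (s := Set.univ.pi fun _ => Set.Icc (-L) L) (MeasurableSet.univ_pi fun _ => measurableSet_Icc)
    have hbox : (WithLp.ofLp : Space d → Fin d → ℝ) ⁻¹'
        (Set.univ.pi fun _ => Set.Icc (-L) L) = box d L := by
      ext x
      simp [box, Pi.le_def, forall_and]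
    rwa [hbox] at this
  exact h1.comp h2

theorem boxMeasure_ac (d : ℕ) (L : ℝ) : boxMeasure d L ≪ volume.restrict (box d L) :=
  Measure.smul_absolutelyContinuous

theorem ac_boxMeasure (hL : 0 < L) : volume.restrict (box d L) ≪ boxMeasure d L :=
  Measure.absolutelyContinuous_smul (pow_ne_zero _ (by simpa using hL))

/-- On the box the identity can fail only on the faces `x i = -L`, which are null. -/
theorem ofTorus_toTorus_ae (hL : 0 < L) :
    ∀ᵐ x ∂boxMeasure d L, ofTorus L (toTorus L x) = x := by
  refine (boxMeasure_ac d L).ae_le ?_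
  have h1 : ∀ᵐ x : Fin d → ℝ, ∀ i, x i ≠ -L := by
    rw [ae_all_iff]
    intro i
    exact (Measure.quasiMeasurePreserving_eval (fun _ : Fin d => (volume : Measure ℝ)) i).ae
      (p := fun t => t ≠ -L) (by simp [ae_iff])
  have h2 : ∀ᵐ x : Space d, ∀ i, x i ≠ -L :=
    (PiLp.volume_preserving_ofLp (Fin d)).quasiMeasurePreserving.ae h1
  have hb : MeasurableSet (box d L) := by
    have : box d L = ⋂ i, (fun x : Space d => x i) ⁻¹' Set.Icc (-L) L := by ext; simp [box]
    rw [this]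
    exact MeasurableSet.iInter fun i => measurableSet_Icc.preimage (by fun_prop)
  filter_upwards [ae_restrict_of_ae h2, ae_restrict_mem hb] with x h hx
  exact ofTorus_toTorus hL fun i => ⟨lt_of_le_of_ne (hx i).1 (h i).symm, (hx i).2⟩

theorem measurePreserving_ofTorus (hL : 0 < L) :
    MeasurePreserving (ofTorus L) volume (boxMeasure d L) := by
  refine ⟨measurable_ofTorus L, ?_⟩
  rw [← (measurePreserving_toTorus hL).map_eq,
    Measure.map_map (measurable_ofTorus L) (measurable_toTorus L),
    Measure.map_congr (f := ofTorus L ∘ toTorus L) (g := id) (ofTorus_toTorus_ae hL), Measure.map_id]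

theorem mFourier_toTorus (hL : 0 < L) (k : Fin d → ℤ) (x : Space d) :
    UnitAddTorus.mFourier k (toTorus L x) = planeWave L k x := by
  simp only [UnitAddTorus.mFourier, ContinuousMap.coe_mk, planeWave, toTorus, toCircle]
  refine Finset.prod_congr rfl fun i _ => ?_
  rw [fourier_coe_apply]
  congr 1
  have : (L : ℂ) ≠ 0 := by exact_mod_cast hL.ne'
  push_cast
  field_simp

/-- The Fourier coefficient `(2L)^{-d} ∫_Ω f W_{-k}`. -/
def boxFourierCoeff (L : ℝ) (f : Space d → ℂ) (k : Fin d → ℤ) : ℂ :=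
  ∫ x, f x * planeWave L (-k) x ∂boxMeasure d L

theorem memLp_comp_ofTorus (hL : 0 < L) {f : Space d → ℂ}
    (hf : MemLp f 2 (volume.restrict (box d L))) : MemLp (f ∘ ofTorus L) 2 volume :=
  (hf.smul_measure (c := (ENNReal.ofReal (2 * L)⁻¹) ^ d)
    (ENNReal.pow_ne_top ENNReal.ofReal_ne_top)).comp_measurePreserving (measurePreserving_ofTorus hL)

theorem mFourierCoeff_comp_ofTorus (hL : 0 < L) {f : Space d → ℂ}
    (hf : MemLp f 2 (volume.restrict (box d L))) (k : Fin d → ℤ) :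
    UnitAddTorus.mFourierCoeff ((memLp_comp_ofTorus hL hf).toLp _) k = boxFourierCoeff L f k := by
  have hW : Continuous (planeWave L (-k) : Space d → ℂ) := by unfold planeWave; fun_prop
  have hmeas : AEStronglyMeasurable (fun x => f x * planeWave L (-k) x) (boxMeasure d L) :=
    (hf.1.mono_ac (boxMeasure_ac d L)).mul hW.aestronglyMeasurable
  rw [boxFourierCoeff, ← (measurePreserving_ofTorus hL).map_eq,
    integral_map (measurable_ofTorus L).aemeasurable
      (by rwa [(measurePreserving_ofTorus hL).map_eq])]
  refine integral_congr_ae ?_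
  filter_upwards [(memLp_comp_ofTorus hL hf).coeFn_toLp] with t ht
  rw [ht, smul_eq_mul, mul_comm, Function.comp_apply, ← mFourier_toTorus hL, toTorus_ofTorus hL]

theorem summable_sq_boxFourierCoeff (hL : 0 < L) {f : Space d → ℂ}
    (hf : MemLp f 2 (volume.restrict (box d L))) :
    Summable fun k => ‖boxFourierCoeff L f k‖ ^ 2 := by
  have := (UnitAddTorus.hasSum_sq_mFourierCoeff ((memLp_comp_ofTorus hL hf).toLp _)).summable
  simpa only [mFourierCoeff_comp_ofTorus hL hf] using this

/-- A square integrable function with absolutely summable Fourier coefficients is almost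
everywhere the sum of its Fourier series. -/
theorem tsum_boxFourierCoeff_ae_eq (hL : 0 < L) {f : Space d → ℂ}
    (hf : MemLp f 2 (volume.restrict (box d L)))
    (hs : Summable fun k => ‖boxFourierCoeff L f k‖) :
    (fun x => ∑' k, boxFourierCoeff L f k * planeWave L k x) =ᵐ[volume.restrict (box d L)] f := by
  set g := (memLp_comp_ofTorus hL hf).toLp _ with hg
  have h1 : HasSum (fun k => boxFourierCoeff L f k • UnitAddTorus.mFourierLp 2 k) g := by
    simpa only [mFourierCoeff_comp_ofTorus hL hf] using UnitAddTorus.hasSum_mFourier_series_L2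
      ((memLp_comp_ofTorus hL hf).toLp _)
  have h2 : Summable fun k => boxFourierCoeff L f k • UnitAddTorus.mFourier (d := Fin d) k :=
    .of_norm (by simpa only [norm_smul, UnitAddTorus.mFourier_norm, mul_one] using hs)
  set G := ∑' k, boxFourierCoeff L f k • UnitAddTorus.mFourier (d := Fin d) k with hG
  -- The series converges uniformly to `G` and in `L²` to `g`; uniform convergence implies `L²`
  -- convergence, so the limits agree.
  have h3 : ContinuousMap.toLp 2 volume ℂ G = g := by
    have := (ContinuousMap.toLp (E := ℂ) 2 (volume : Measure (UnitAddTorus (Fin d))) ℂ).hasSum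
      h2.hasSum
    exact this.unique (by simpa [Function.comp_def] using h1)
  have h4 : (G : UnitAddTorus (Fin d) → ℂ) =ᵐ[volume] f ∘ ofTorus L :=
    (ContinuousMap.coeFn_toLp volume G).symm.trans
      ((Filter.EventuallyEq.of_eq (by rw [h3])).trans (memLp_comp_ofTorus hL hf).coeFn_toLp)
  have h5 := (measurePreserving_toTorus hL).quasiMeasurePreserving.ae_eq_comp h4
  refine (ac_boxMeasure hL).ae_le ?_
  filter_upwards [h5, ofTorus_toTorus_ae hL] with x hx hx'
  simp only [Function.comp_apply, hx'] at hx
  rw [← hx, hG, ← ContinuousMap.tsum_apply h2]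
  simp [mFourier_toTorus hL]

end Torus

/-! ### Derivatives and algebra of plane waves -/

section PlaneWave

variable {d : ℕ} {L : ℝ}

/-- The linear form `x ↦ ∑ i, π k_i x_i / L`. -/
def phase (L : ℝ) (k : Fin d → ℤ) : Space d →L[ℝ] ℝ :=
  ∑ i, (Real.pi * k i / L) • (EuclideanSpace.proj i : Space d →L[ℝ] ℝ)

theorem phase_apply (k : Fin d → ℤ) (x : Space d) :
    phase L k x = ∑ i, Real.pi * k i / L * x i := by
  simp [phase]

/-- Factoring out the value at 0 makes the wave a one-variable exponential composed with a linear
form, from which smoothness and all derivatives are read off. -/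
theorem planeWave_eq_exp_phase (k : Fin d → ℤ) (x : Space d) :
    planeWave L k x = planeWave L k 0 * Complex.exp (Complex.I * (phase L k x : ℂ)) := by
  simp only [planeWave, ← Complex.exp_sum, ← Complex.exp_add, phase_apply]
  congr 1
  simp only [PiLp.zero_apply, Complex.ofReal_sum, Finset.mul_sum, ← Finset.sum_add_distrib]
  refine Finset.sum_congr rfl fun i _ => ?_
  push_cast
  ring

theorem norm_planeWave (k : Fin d → ℤ) (x : Space d) : ‖planeWave L k x‖ = 1 := by
  simp only [planeWave, norm_prod]
  exact Finset.prod_eq_one fun i _ => by rw [mul_comm]; exact Complex.norm_exp_ofReal_mul_I _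

theorem contDiff_planeWave {n : WithTop ℕ∞} (k : Fin d → ℤ) :
    ContDiff ℝ n (planeWave L k : Space d → ℂ) := by
  have : (planeWave L k : Space d → ℂ) =
      fun x => planeWave L k 0 * Complex.exp (Complex.I * (phase L k x : ℂ)) :=
    funext (planeWave_eq_exp_phase k)
  rw [this]
  exact contDiff_const.mul (contDiff_const.mul
    (Complex.ofRealCLM.contDiff.comp (phase L k).contDiff)).cexp

theorem planeWave_periodic (hL : 0 < L) (k : Fin d → ℤ) : IsPeriodic L (planeWave L k) := by
  intro i x
  rw [planeWave_eq_exp_phase, planeWave_eq_exp_phase k x, map_add]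
  have h : phase L k (EuclideanSpace.single i (2 * L)) = 2 * Real.pi * k i := by
    simp only [phase_apply, PiLp.single_apply, mul_ite, mul_zero, Finset.sum_ite_eq',
      Finset.mem_univ, if_true]
    field_simp
  rw [h]
  push_cast
  rw [mul_add, Complex.exp_add,
    show Complex.I * (2 * Real.pi * (k i : ℂ)) = (k i : ℂ) * (2 * Real.pi * Complex.I) by ring,
    Complex.exp_int_mul_two_pi_mul_I, mul_one]

theorem planeWave_add (k l : Fin d → ℤ) (x : Space d) :
    planeWave L (k + l) x = planeWave L k x * planeWave L l x := by
  simp only [planeWave, ← Finset.prod_mul_distrib, ← Complex.exp_add]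
  refine Finset.prod_congr rfl fun i _ => ?_
  congr 1
  simp only [Pi.add_apply]
  push_cast
  ring

theorem planeWave_neg (k : Fin d → ℤ) (x : Space d) :
    planeWave L (-k) x = star (planeWave L k x) := by
  simp only [planeWave, star_prod]
  refine Finset.prod_congr rfl fun i _ => ?_
  rw [Complex.star_def, ← Complex.exp_conj]
  congr 1
  simp only [Pi.neg_apply, map_mul, Complex.conj_I, Complex.conj_ofReal]
  push_cast
  ring

theorem norm_phase_le (hL : 0 < L) (k : Fin d → ℤ) : ‖phase L k‖ ≤ Real.pi * d / L * ‖k‖ := by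
  refine (norm_sum_le _ _).trans ?_
  have h : ∀ i ∈ (Finset.univ : Finset (Fin d)),
      ‖(Real.pi * k i / L) • (EuclideanSpace.proj i : Space d →L[ℝ] ℝ)‖ ≤
        Real.pi / L * ‖k‖ := fun i _ => by
    have h1 : ‖(EuclideanSpace.proj i : Space d →L[ℝ] ℝ)‖ ≤ 1 :=
      ContinuousLinearMap.opNorm_le_bound _ zero_le_one fun x => by
        simpa using PiLp.norm_apply_le x i
    have h2 : |(k i : ℝ)| ≤ ‖k‖ := by
      simpa only [Int.norm_eq_abs] using norm_le_pi_norm k i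
    rw [norm_smul, Real.norm_eq_abs, abs_div, abs_mul, abs_of_pos Real.pi_pos, abs_of_pos hL]
    calc Real.pi * |(k i : ℝ)| / L * _ ≤ Real.pi * ‖k‖ / L * 1 := by gcongr
      _ = _ := by ring
  refine (Finset.sum_le_sum h).trans (le_of_eq ?_)
  simp
  ring

/-- Every derivative of the one-variable exponential has modulus 1, so the `n`-th derivative of the
composition costs only `‖phase L k‖ ^ n`. -/
theorem norm_iteratedFDeriv_planeWave_le (hL : 0 < L) (k : Fin d → ℤ) (n : ℕ) (x : Space d) :
    ‖iteratedFDeriv ℝ n (planeWave L k) x‖ ≤ (Real.pi * d / L * ‖k‖) ^ n := by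
  set e : ℝ → ℂ := fun t => planeWave L k (0 : Space d) * Complex.exp (Complex.I * (t : ℂ)) with he
  have hc : ContDiff ℝ ∞ e :=
    contDiff_const.mul (contDiff_const.mul Complex.ofRealCLM.contDiff).cexp
  have hd : ∀ n : ℕ, iteratedDeriv n e = fun t => Complex.I ^ n * e t := by
    intro n
    induction n with
    | zero => simp
    | succ n ih =>
      ext t
      rw [iteratedDeriv_succ, ih]
      have : HasDerivAt e (Complex.I * e t) t := by
        have h1 : HasDerivAt (fun t : ℝ => Complex.exp (Complex.I * (t : ℂ)))
            (Complex.exp (Complex.I * (t : ℂ)) * (Complex.I * 1)) t :=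
          ((Complex.ofRealCLM.hasDerivAt (x := t)).const_mul Complex.I).cexp
        exact (h1.const_mul (planeWave L k (0 : Space d))).congr_deriv (by rw [he]; ring)
      rw [(this.const_mul _).deriv]
      ring
  have hn : ∀ t, ‖e t‖ = 1 := fun t => by
    rw [he, norm_mul, norm_planeWave, mul_comm Complex.I, Complex.norm_exp_ofReal_mul_I, one_mul]
  have hcomp : planeWave L k = e ∘ phase L k := funext (planeWave_eq_exp_phase k)
  rw [hcomp, ContinuousLinearMap.iteratedFDeriv_comp_right (phase L k) hc x
    (by exact_mod_cast le_top)]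
  refine (ContinuousMultilinearMap.norm_compContinuousLinearMap_le _ _).trans ?_
  rw [norm_iteratedFDeriv_eq_norm_iteratedDeriv, hd, norm_mul, hn, norm_pow, Complex.norm_I]
  simp only [one_pow, one_mul, Finset.prod_const, Finset.card_univ, Fintype.card_fin]
  gcongr
  exact norm_phase_le hL k

/-- The factor `c` keeps the family closed under differentiation, so that the formula can be
iterated. -/
theorem partialDeriv_const_mul_planeWave (i : Fin d) (c : ℂ) (k : Fin d → ℤ) :
    partialDeriv i (fun x => c * planeWave L k x) =
      fun x => (c * (Complex.I * (Real.pi * k i / L : ℝ))) * planeWave L k x := by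
  ext x
  have h1 : HasFDerivAt (fun x : Space d => Complex.exp (Complex.I * (phase L k x : ℂ)))
      (Complex.exp (Complex.I * (phase L k x : ℂ)) •
        (Complex.I • (Complex.ofRealCLM ∘L phase L k))) x :=
    (((Complex.ofRealCLM ∘L phase L k).hasFDerivAt).const_mul Complex.I).cexp
  have h2 := h1.const_mul (c * planeWave L k (0 : Space d))
  have h3 : (fun x : Space d => c * planeWave L k x) = fun x =>
      c * planeWave L k (0 : Space d) * Complex.exp (Complex.I * (phase L k x : ℂ)) := by
    ext x; rw [planeWave_eq_exp_phase]; ring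
  have h4 : phase L k (EuclideanSpace.single i 1) = Real.pi * k i / L := by
    simp [phase_apply, PiLp.single_apply]
  rw [partialDeriv, h3, h2.fderiv, planeWave_eq_exp_phase k x]
  simp only [smul_apply, ContinuousLinearMap.comp_apply, h4, smul_eq_mul,
    Complex.ofRealCLM_apply]
  ring

theorem multiDeriv_planeWave (α : Fin d → ℕ) (k : Fin d → ℤ) :
    multiDeriv α (planeWave L k) =
      fun x => (∏ i, (Complex.I * (Real.pi * k i / L : ℝ)) ^ α i) * planeWave L k x := by
  have hit : ∀ (i : Fin d) (n : ℕ) (c : ℂ),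
      (partialDeriv i)^[n] (fun x => c * planeWave L k x) =
        fun x => ((Complex.I * (Real.pi * k i / L : ℝ)) ^ n * c) * planeWave L k x := by
    intro i n c
    induction n generalizing c with
    | zero => simp
    | succ n ih =>
      rw [Function.iterate_succ_apply, partialDeriv_const_mul_planeWave, ih]
      ext x; ring
  have hl : ∀ l : List (Fin d),
      l.foldr (fun i g => (partialDeriv i)^[α i] g) (planeWave L k) = fun x =>
        (l.map fun i => (Complex.I * (Real.pi * k i / L : ℝ)) ^ α i).prod * planeWave L k x := by
    intro l
    induction l with
    | nil => simp
    | cons i l ih => rw [List.foldr_cons, ih, hit, List.map_cons, List.prod_cons]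
  rw [multiDeriv, hl, Fin.prod_univ_def]

end PlaneWave

/-! ### Lattice sums and their tails -/

section Lattice

variable {d : ℕ}

/-- `ℤ^d` is identified, with its sup norm, with the lattice spanned by the standard basis, to which
summability above the rank applies. The term `k = 0` is 0. -/
theorem summable_inv_norm_pow {s : ℕ} (hs : d < s) :
    Summable fun k : Fin d → ℤ => ‖k‖⁻¹ ^ s := by
  let b := Pi.basisFun ℝ (Fin d)
  let Λ := Submodule.span ℤ (Set.range b)
  have hr : Module.finrank ℤ Λ = d := by
    rw [ZLattice.rank ℝ Λ]; simp
  let ι : (Fin d → ℤ) → Λ := fun k => ∑ i, k i • b.restrictScalars ℤ i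
  have hι : ∀ k, ((ι k : Λ) : Fin d → ℝ) = fun i => (k i : ℝ) := by
    intro k
    ext j
    simp [ι, b, Pi.single_apply]
  have hinj : Function.Injective ι := fun k l h => by
    have := congrArg (fun z : Λ => (z : Fin d → ℝ)) h
    simp only [hι] at this
    ext i
    exact_mod_cast congrFun this i
  have h := (ZLattice.summable_norm_pow_inv Λ s (by rwa [hr])).comp_injective hinj
  refine h.congr fun k => ?_
  have : ‖ι k‖ = ‖k‖ := by
    change ‖((ι k : Λ) : Fin d → ℝ)‖ = _
    rw [hι]
    simp only [Pi.norm_def]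
    congr 2
  simp only [Function.comp_apply, this]

/-- For the componentwise floor quotient `q` one has `M |q_i| ≤ |k_i| + M ≤ 2 ‖k‖`. Moreover `q ≠
0`, since `q = 0` would force `0 ≤ k_i < M` for all `i`; this matters because `0⁻¹ = 0`. -/
theorem inv_norm_pow_le_of_le_norm {s M : ℕ} (hM : 0 < M) (k : Fin d → ℤ) (hk : (M : ℝ) ≤ ‖k‖) :
    ‖k‖⁻¹ ^ s ≤ (2 / (M : ℝ)) ^ s * ‖fun i => k i / (M : ℤ)‖⁻¹ ^ s := by
  have hM' : (0 : ℝ) < M := by exact_mod_cast hM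
  set q : Fin d → ℤ := fun i => k i / (M : ℤ) with hq
  have h1 : ‖q‖ ≤ 2 / M * ‖k‖ := by
    refine (pi_norm_le_iff_of_nonneg (by positivity)).2 fun i => ?_
    have h2 : ‖k i‖ ≤ ‖k‖ := norm_le_pi_norm k i
    rw [Int.norm_eq_abs] at h2 ⊢
    have h3 : (M : ℝ) * (q i : ℝ) ≤ k i := by
      exact_mod_cast Int.mul_ediv_self_le (x := k i) (k := (M : ℤ)) (by omega)
    have h4 : (k i : ℝ) < M * (q i : ℝ) + M := by
      exact_mod_cast Int.lt_mul_ediv_self_add (x := k i) (k := (M : ℤ)) (by omega)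
    rw [div_mul_eq_mul_div, le_div_iff₀ hM', ← abs_of_pos hM', ← abs_mul, abs_le]
    have h5 := abs_le.1 h2
    constructor <;> linarith [h5.1, h5.2]
  have h2 : 0 < ‖q‖ := by
    rw [norm_pos_iff]
    intro h0
    refine absurd hk (not_le.2 ((pi_norm_lt_iff hM').2 fun i => ?_))
    have h3 : k i / (M : ℤ) = 0 := congrFun h0 i
    have h4 := Int.emod_nonneg (k i) (b := (M : ℤ)) (by omega)
    have h5 := Int.emod_lt_of_pos (k i) (b := (M : ℤ)) (by omega)
    have h6 := Int.mul_ediv_add_emod (k i) M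
    rw [h3, mul_zero, zero_add] at h6
    rw [h6] at h4 h5
    rw [Int.norm_eq_abs, abs_of_nonneg (by exact_mod_cast h4)]
    exact_mod_cast h5
  rw [← mul_pow]
  have hk0 : 0 < ‖k‖ := hM'.trans_le hk
  gcongr
  rw [inv_le_iff_one_le_mul₀ hk0, mul_right_comm, ← div_eq_mul_inv, one_le_div h2]
  exact h1

/-- `∑_{‖k‖ ≥ M} ‖k‖^{-s} = O(M^{d-s})`. -/
theorem exists_tail_inv_norm_pow_le {s : ℕ} (hs : d < s) :
    ∃ C : ℝ, 0 ≤ C ∧ ∀ M : ℕ, 0 < M →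
      ∑' k : Fin d → ℤ, (if (M : ℝ) ≤ ‖k‖ then ‖k‖⁻¹ ^ s else 0) ≤ C * ((M : ℝ) ^ d / M ^ s) := by
  refine ⟨2 ^ s * ∑' k : Fin d → ℤ, ‖k‖⁻¹ ^ s, by positivity, fun M hM => ?_⟩
  have hne : NeZero M := ⟨hM.ne'⟩
  -- Division with remainder, `k = M q + r`: the majorant depends on `q` alone, and each `q` occurs
  -- for `M ^ d` remainders.
  let e : (Fin d → ℤ) ≃ (Fin d → ℤ) × (Fin d → Fin M) :=
    (Equiv.arrowCongr (Equiv.refl _) (Int.divModEquiv M)).trans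
      (Equiv.arrowProdEquivProdArrow (Fin d) (fun _ => ℤ) (fun _ => Fin M))
  have he : ∀ k, (e k).1 = fun i => k i / (M : ℤ) := fun k => rfl
  have hS := summable_inv_norm_pow (d := d) hs
  have hP : Summable fun p : (Fin d → ℤ) × (Fin d → Fin M) =>
      (2 / (M : ℝ)) ^ s * ‖p.1‖⁻¹ ^ s := by
    have := (hS.mul_left ((2 / (M : ℝ)) ^ s)).mul_of_nonneg
      (Summable.of_finite (f := fun _ : Fin d → Fin M => (1 : ℝ)))
      (fun _ => by positivity) (fun _ => zero_le_one)
    simpa using this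
  have hle : ∀ k, (if (M : ℝ) ≤ ‖k‖ then ‖k‖⁻¹ ^ s else 0) ≤
      (2 / (M : ℝ)) ^ s * ‖(e k).1‖⁻¹ ^ s := fun k => by
    split_ifs with hk
    · rw [he]; exact inv_norm_pow_le_of_le_norm hM k hk
    · positivity
  have hPe := (e.summable_iff).2 hP
  calc ∑' k : Fin d → ℤ, (if (M : ℝ) ≤ ‖k‖ then ‖k‖⁻¹ ^ s else 0)
      ≤ ∑' k, (2 / (M : ℝ)) ^ s * ‖(e k).1‖⁻¹ ^ s := by
        refine Summable.tsum_le_tsum hle (hPe.of_nonneg_of_le (fun k => ?_) hle) hPe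
        split_ifs <;> positivity
    _ = ∑' p : (Fin d → ℤ) × (Fin d → Fin M), (2 / (M : ℝ)) ^ s * ‖p.1‖⁻¹ ^ s :=
        e.tsum_eq (fun p => (2 / (M : ℝ)) ^ s * ‖p.1‖⁻¹ ^ s)
    _ = ∑' q : Fin d → ℤ, (M : ℝ) ^ d * ((2 / (M : ℝ)) ^ s * ‖q‖⁻¹ ^ s) := by
        rw [hP.tsum_prod' fun q => Summable.of_finite]
        simp
    _ = _ := by
        rw [tsum_mul_left, tsum_mul_left, div_pow]
        ring

/-- Cauchy-Schwarz for the tail of a weighted sequence. -/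
theorem exists_tail_weighted_le {m : ℕ} (hm : (d : ℝ) / 2 + 2 < m) {a : (Fin d → ℤ) → ℂ}
    (ha : Summable fun k => (‖k‖ ^ m * ‖a k‖) ^ 2) :
    ∃ C : ℝ, 0 ≤ C ∧ ∀ M : ℕ, 0 < M →
      Summable (fun k => if (M : ℝ) ≤ ‖k‖ then ‖k‖ ^ 2 * ‖a k‖ else 0) ∧
      ∑' k, (if (M : ℝ) ≤ ‖k‖ then ‖k‖ ^ 2 * ‖a k‖ else 0) ≤
        C * (M : ℝ) ^ (-((m : ℝ) - (d : ℝ) / 2 - 2)) := by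
  obtain ⟨p, rfl⟩ : ∃ p, m = p + 2 := Nat.exists_eq_add_of_le' (by
    have : (2 : ℝ) ≤ m := by have : (0 : ℝ) ≤ d := d.cast_nonneg; linarith
    exact_mod_cast this)
  have hs : d < 2 * p := by
    have : (d : ℝ) < 2 * p := by push_cast at hm; linarith
    exact_mod_cast this
  obtain ⟨C, hC0, hC⟩ := exists_tail_inv_norm_pow_le hs
  set S := ∑' k, (‖k‖ ^ (p + 2) * ‖a k‖) ^ 2 with hSdef
  have hS0 : 0 ≤ S := tsum_nonneg fun _ => by positivity
  refine ⟨(S + C) / 2, by positivity, fun M hM => ?_⟩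
  have hM' : (0 : ℝ) < M := by exact_mod_cast hM
  -- `ε` is the target rate and `ε²` the size of the tail of `‖k‖^(-2p)`. With this weight, `u v ≤ ε
  -- u² / 2 + v² / (2 ε)` makes both sums `O(ε)`.
  set ε : ℝ := (M : ℝ) ^ (-(((p + 2 : ℕ) : ℝ) - (d : ℝ) / 2 - 2)) with hε
  have hε0 : 0 < ε := Real.rpow_pos_of_pos hM' _
  have hε2 : (M : ℝ) ^ d / M ^ (2 * p) = ε * ε := by
    rw [hε, ← Real.rpow_add hM', ← Real.rpow_natCast, ← Real.rpow_natCast, ← Real.rpow_sub hM']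
    congr 1
    push_cast
    ring
  have hT : Summable fun k : Fin d → ℤ => if (M : ℝ) ≤ ‖k‖ then ‖k‖⁻¹ ^ (2 * p) else 0 :=
    (summable_inv_norm_pow hs).of_nonneg_of_le (fun k => by split_ifs <;> positivity)
      fun k => by split_ifs <;> [exact le_rfl; positivity]
  have hle : ∀ k, (if (M : ℝ) ≤ ‖k‖ then ‖k‖ ^ 2 * ‖a k‖ else 0) ≤
      ε / 2 * (‖k‖ ^ (p + 2) * ‖a k‖) ^ 2 +
        (2 * ε)⁻¹ * (if (M : ℝ) ≤ ‖k‖ then ‖k‖⁻¹ ^ (2 * p) else 0) := fun k => by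
    split_ifs with hk
    · have hk0 : 0 < ‖k‖ := hM'.trans_le hk
      have h1 : ‖k‖ ^ 2 * ‖a k‖ = (‖k‖ ^ (p + 2) * ‖a k‖) * ‖k‖⁻¹ ^ p := by
        rw [inv_pow]; field_simp; ring
      rw [h1, pow_mul', ← sub_nonneg]
      set u := ‖k‖ ^ (p + 2) * ‖a k‖
      set v := ‖k‖⁻¹ ^ p
      have h2 : ε / 2 * u ^ 2 + (2 * ε)⁻¹ * v ^ 2 - u * v = (2 * ε)⁻¹ * (ε * u - v) ^ 2 := by
        field_simp; ring
      rw [h2]; positivity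
    · positivity
  have hR := (ha.mul_left (ε / 2)).add (hT.mul_left (2 * ε)⁻¹)
  have hL := hR.of_nonneg_of_le (fun k => by split_ifs <;> positivity) hle
  refine ⟨hL, (Summable.tsum_le_tsum hle hL hR).trans ?_⟩
  rw [Summable.tsum_add (ha.mul_left _) (hT.mul_left _), tsum_mul_left, tsum_mul_left, ← hSdef]
  calc ε / 2 * S + (2 * ε)⁻¹ * _ ≤ ε / 2 * S + (2 * ε)⁻¹ * (C * (ε * ε)) := by
        gcongr; rw [← hε2]; exact hC M hM
    _ = _ := by field_simp

end Lattice

/-! ### Fourier decay from weak derivatives -/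

section Sobolev

variable {d : ℕ} {L : ℝ}

/-- Testing against `W_{-k}`, the pure derivative of order `m` in direction `i` becomes
multiplication by `(π k_i / L) ^ m`, up to a unimodular factor. -/
theorem norm_boxFourierCoeff_of_weakDeriv (hL : 0 < L) {f g : Space d → ℂ} {i : Fin d} {m : ℕ}
    (h : IsPeriodicWeakDeriv L (Pi.single i m) f g) (k : Fin d → ℤ) :
    (Real.pi / L) ^ m * (|(k i : ℝ)| ^ m * ‖boxFourierCoeff L f k‖) = ‖boxFourierCoeff L g k‖ := by
  have h1 := h _ (contDiff_planeWave (-k)) (planeWave_periodic hL (-k))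
  rw [multiDeriv_planeWave] at h1
  have h2 : ∏ j, (Complex.I * (Real.pi * ((-k) j : ℤ) / L : ℝ)) ^ (Pi.single i m : Fin d → ℕ) j =
      (Complex.I * (Real.pi * ((-k) i : ℤ) / L : ℝ)) ^ m := by
    rw [Finset.prod_eq_single i (fun j _ hj => by simp [hj]) (by simp), Pi.single_eq_same]
  simp only [h2, mul_left_comm (_ : ℂ) (_ ^ m : ℂ) _, integral_const_mul] at h1
  have h3 := congrArg norm h1
  simp only [norm_mul, norm_pow, norm_neg, norm_one, one_pow, one_mul, Complex.norm_I,
    Complex.norm_real, Pi.neg_apply, Int.cast_neg, Real.norm_eq_abs, abs_div, abs_mul, abs_neg,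
    abs_of_pos Real.pi_pos, abs_of_pos hL] at h3
  simp only [boxFourierCoeff, boxMeasure, integral_smul_measure, norm_smul]
  rw [← h3]
  ring

/-- Pure derivatives suffice: the sup norm `‖k‖` is attained at some coordinate, so the weight is at
most the sum of the coordinate weights. -/
theorem summable_sobolev_weight (hd : 1 ≤ d) (hL : 0 < L) {m : ℕ} {f : Space d → ℂ}
    (hf : MemPeriodicSobolev L m f) :
    Summable fun k => (‖k‖ ^ m * ‖boxFourierCoeff L f k‖) ^ 2 := by
  have hi : ∀ i : Fin d, Summable fun k : Fin d → ℤ =>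
      (|(k i : ℝ)| ^ m * ‖boxFourierCoeff L f k‖) ^ 2 := by
    intro i
    obtain ⟨g, hg, hfg⟩ := hf.2 (Pi.single i m) (by simp)
    have hpos : 0 < (Real.pi / L) ^ m := by positivity
    refine ((summable_sq_boxFourierCoeff hL hg).mul_left (((Real.pi / L) ^ m)⁻¹ ^ 2)).congr
      fun k => ?_
    rw [← norm_boxFourierCoeff_of_weakDeriv hL hfg k]
    field_simp
  refine (summable_sum fun i (_ : i ∈ Finset.univ) => hi i).of_nonneg_of_le
    (fun k => by positivity) fun k => ?_
  have : Nonempty (Fin d) := ⟨⟨0, hd⟩⟩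
  obtain ⟨i, hi⟩ := Finite.exists_max fun i => ‖k i‖
  have hik : ‖k‖ ≤ |(k i : ℝ)| := (pi_norm_le_iff_of_nonneg (abs_nonneg _)).2 hi
  refine le_trans (by gcongr) (Finset.single_le_sum (f := fun i => (|(k i : ℝ)| ^ m * ‖boxFourierCoeff L f k‖) ^ 2)
    (fun _ _ => by positivity) (Finset.mem_univ i))

end Sobolev

/-! ### Discrete orthogonality and aliasing -/

section Aliasing

variable {d : ℕ} {L : ℝ}

theorem sum_exp_two_pi_div {N : ℕ} (hN : 0 < N) (j : ℤ) :
    ∑ n : Fin N, Complex.exp (2 * Real.pi * Complex.I * j / N * (n : ℕ)) =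
      if (N : ℤ) ∣ j then (N : ℂ) else 0 := by
  have hN' : (N : ℂ) ≠ 0 := by exact_mod_cast hN.ne'
  have hpi : (2 * Real.pi * Complex.I : ℂ) ≠ 0 := Complex.two_pi_I_ne_zero
  set ζ := Complex.exp (2 * Real.pi * Complex.I * j / N) with hζ
  have h1 : ∀ n : ℕ, Complex.exp (2 * Real.pi * Complex.I * j / N * n) = ζ ^ n := fun n => by
    rw [hζ, ← Complex.exp_nat_mul, mul_comm]
  simp only [h1, Fin.sum_univ_eq_sum_range (fun n => ζ ^ n)]
  split_ifs with h
  · obtain ⟨l, rfl⟩ := h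
    have : ζ = 1 := by
      rw [hζ, Complex.exp_eq_one_iff]
      refine ⟨l, ?_⟩
      push_cast
      field_simp
    simp [this]
  · have hne : ζ ≠ 1 := by
      intro h2
      rw [hζ, Complex.exp_eq_one_iff] at h2
      obtain ⟨l, hl⟩ := h2
      refine h ⟨l, ?_⟩
      have h3 : (j : ℂ) = N * l := by
        field_simp at hl
        exact hl
      exact_mod_cast h3
    have hpow : ζ ^ N = 1 := by
      rw [← h1, div_mul_cancel₀ _ hN', Complex.exp_eq_one_iff]
      exact ⟨j, by ring⟩
    have := mul_geom_sum ζ N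
    rw [hpow, sub_self] at this
    exact (mul_eq_zero.1 this).resolve_left (sub_ne_zero.2 hne)

theorem planeWave_gridPoint (hL : 0 < L) {N : ℕ} (k : Fin d → ℤ) (n : Fin d → Fin N) :
    planeWave L k (gridPoint L N n) =
      ∏ i, Complex.exp (2 * Real.pi * Complex.I * k i / N * (n i : ℕ)) := by
  refine Finset.prod_congr rfl fun i _ => ?_
  congr 1
  have : (L : ℂ) ≠ 0 := by exact_mod_cast hL.ne'
  simp only [gridPoint]
  push_cast
  field_simp
  ring

/-- The grid sum factors over coordinates into geometric sums of roots of unity. -/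
theorem discreteFourierCoeff_planeWave (hL : 0 < L) {N : ℕ} (hN : 0 < N) (k l : Fin d → ℤ) :
    discreteFourierCoeff L N (planeWave L l) k = if ∀ i, (N : ℤ) ∣ l i - k i then 1 else 0 := by
  have hN' : (N : ℂ) ≠ 0 := by exact_mod_cast hN.ne'
  have hW : ∀ n : Fin d → Fin N, planeWave L l (gridPoint L N n) *
      star (planeWave L k (gridPoint L N n)) =
        ∏ i, Complex.exp (2 * Real.pi * Complex.I * (l i - k i : ℤ) / N * (n i : ℕ)) := fun n => by
    rw [← planeWave_neg, ← planeWave_add, ← sub_eq_add_neg, planeWave_gridPoint hL]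
    rfl
  simp only [discreteFourierCoeff, hW]
  rw [← Fintype.piFinset_univ, ← Finset.prod_univ_sum (fun _ => Finset.univ)
    (fun i (n : Fin N) => Complex.exp (2 * Real.pi * Complex.I * (l i - k i : ℤ) / N * (n : ℕ)))]
  simp only [sum_exp_two_pi_div hN]
  split_ifs with h
  · rw [Finset.prod_congr rfl fun i _ => if_pos (h i)]
    simp [hN']
  · push Not at h
    obtain ⟨i, hi⟩ := h
    rw [Finset.prod_eq_zero (Finset.mem_univ i) (if_neg hi), mul_zero]

/-- The representative of `k` modulo `2M` with components in `[-M, M)`. -/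
def aliasFrequency (M : ℕ) (k : Fin d → ℤ) : Fin d → ℤ :=
  fun i => (k i + M) % (2 * M : ℕ) - M

theorem mem_frequencies {M : ℕ} {k : Fin d → ℤ} :
    k ∈ frequencies d (2 * M) ↔ ∀ i, -(M : ℤ) ≤ k i ∧ k i < M := by
  simp [frequencies]

theorem aliasFrequency_mem {M : ℕ} (hM : 0 < M) (k : Fin d → ℤ) :
    aliasFrequency M k ∈ frequencies d (2 * M) := by
  refine mem_frequencies.2 fun i => ?_
  have h4 := Int.emod_nonneg (k i + M) (b := ((2 * M : ℕ) : ℤ)) (by omega)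
  have h5 := Int.emod_lt_of_pos (k i + M) (b := ((2 * M : ℕ) : ℤ)) (by omega)
  simp only [aliasFrequency]
  omega

theorem aliasFrequency_eq_iff {M : ℕ} {k l : Fin d → ℤ}
    (hk : k ∈ frequencies d (2 * M)) :
    (∀ i, ((2 * M : ℕ) : ℤ) ∣ l i - k i) ↔ aliasFrequency M l = k := by
  rw [funext_iff]
  refine forall_congr' fun i => ?_
  obtain ⟨h1, h2⟩ := mem_frequencies.1 hk i
  have h3 : (k i + M) % ((2 * M : ℕ) : ℤ) = k i + M := Int.emod_eq_of_lt (by omega) (by omega)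
  rw [aliasFrequency, sub_eq_iff_eq_add]
  conv_rhs => rw [← h3]
  rw [show l i - k i = (l i + M) - (k i + M) by ring]
  exact Int.modEq_iff_dvd.symm.trans eq_comm

theorem interpolant_planeWave (hL : 0 < L) {M : ℕ} (hM : 0 < M) (l : Fin d → ℤ) (x : Space d) :
    interpolant L (2 * M) (planeWave L l) x = planeWave L (aliasFrequency M l) x := by
  rw [interpolant, Finset.sum_eq_single (aliasFrequency M l)]
  · rw [discreteFourierCoeff_planeWave hL (by omega),
      if_pos ((aliasFrequency_eq_iff (aliasFrequency_mem hM l)).2 rfl), one_mul]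
  · intro k hk hne
    rw [discreteFourierCoeff_planeWave hL (by omega),
      if_neg fun h => hne ((aliasFrequency_eq_iff hk).1 h).symm, zero_mul]
  · exact fun h => absurd (aliasFrequency_mem hM l) h

theorem norm_aliasFrequency_le {M : ℕ} (hM : 0 < M) (k : Fin d → ℤ) :
    ‖aliasFrequency M k‖ ≤ M := by
  refine (pi_norm_le_iff_of_nonneg M.cast_nonneg).2 fun i => ?_
  obtain ⟨h1, h2⟩ := mem_frequencies.1 (aliasFrequency_mem hM k) i
  rw [Int.norm_eq_abs, abs_le]
  exact ⟨by exact_mod_cast h1, by exact_mod_cast h2.le⟩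

/-- Hence low frequencies are interpolated exactly and contribute nothing to the error. -/
theorem aliasFrequency_of_norm_lt {M : ℕ} {k : Fin d → ℤ} (hk : ‖k‖ < M) :
    aliasFrequency M k = k := by
  refine (aliasFrequency_eq_iff (mem_frequencies.2 fun i => ?_)).1 fun i => by simp
  have h := (norm_le_pi_norm k i).trans_lt hk
  rw [Int.norm_eq_abs, abs_lt] at h
  exact ⟨by exact_mod_cast h.1.le, by exact_mod_cast h.2⟩

/-- The interpolant of an absolutely convergent Fourier series. -/
theorem hasSum_interpolant (hL : 0 < L) {M : ℕ} (hM : 0 < M) {a : (Fin d → ℤ) → ℂ}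
    (ha : Summable fun k => ‖a k‖) (x : Space d) :
    HasSum (fun k => a k * planeWave L (aliasFrequency M k) x)
      (interpolant L (2 * M) (fun y => ∑' k, a k * planeWave L k y) x) := by
  have hF : ∀ y : Space d, HasSum (fun k => a k * planeWave L k y)
      (∑' k, a k * planeWave L k y) := fun y =>
    (Summable.of_norm (by simpa only [norm_mul, norm_planeWave, mul_one] using ha)).hasSum
  have h := hasSum_sum fun l (_ : l ∈ frequencies d (2 * M)) =>
    ((hasSum_sum fun n (_ : n ∈ (Finset.univ : Finset (Fin d → Fin (2 * M)))) =>
      (hF (gridPoint L (2 * M) n)).mul_right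
        (star (planeWave L l (gridPoint L (2 * M) n)))).mul_left
      (1 / ((2 * M : ℕ) : ℂ) ^ d)).mul_right (planeWave L l x)
  refine HasSum.congr_fun h fun k => ?_
  rw [← interpolant_planeWave hL hM, interpolant, Finset.mul_sum]
  refine Finset.sum_congr rfl fun l _ => ?_
  rw [discreteFourierCoeff, Finset.mul_sum, Finset.mul_sum, Finset.sum_mul, Finset.sum_mul,
    Finset.mul_sum]
  refine Finset.sum_congr rfl fun n _ => ?_
  ring

theorem contDiff_interpolant {n : WithTop ℕ∞} (N : ℕ) (F : Space d → ℂ) :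
    ContDiff ℝ n (interpolant L N F) :=
  ContDiff.sum fun k _ => contDiff_const.mul (contDiff_planeWave k)

end Aliasing

/-! ### The `C²` representative and its interpolation error -/

section Error

variable {d : ℕ} {L : ℝ}

theorem norm_laplacian_le (f : Space d → ℂ) (x : Space d) :
    ‖Laplacian.laplacian f x‖ ≤ d * ‖iteratedFDeriv ℝ 2 f x‖ := by
  rw [InnerProductSpace.laplacian_eq_iteratedFDeriv_orthonormalBasis f
    (EuclideanSpace.basisFun (Fin d) ℝ)]
  refine (norm_sum_le _ _).trans ?_
  refine (Finset.sum_le_sum fun i _ => (iteratedFDeriv ℝ 2 f x).le_opNorm _).trans ?_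
  simp [Fin.prod_univ_two]

/-- Used with `l` the alias of `k` and `R = ‖k‖`; the bound `1 ≤ R` lets `R ^ 2` cover all orders up
to two. -/
theorem norm_iteratedFDeriv_mul_planeWave_sub_le (hL : 0 < L) (a : ℂ) (k l : Fin d → ℤ)
    {R : ℝ} (hR : 1 ≤ R) (hk : ‖k‖ ≤ R) (hl : ‖l‖ ≤ R) {n : ℕ} (hn : n ≤ 2) (x : Space d) :
    ‖iteratedFDeriv ℝ n (fun y => a * (planeWave L k y - planeWave L l y)) x‖ ≤
      2 * (1 + Real.pi * d / L) ^ 2 * (R ^ 2 * ‖a‖) := by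
  have hb : ∀ p : Fin d → ℤ, ‖p‖ ≤ R →
      ‖iteratedFDeriv ℝ n (planeWave L p) x‖ ≤ (1 + Real.pi * d / L) ^ 2 * R ^ 2 := by
    intro p hp
    have hc : 0 ≤ Real.pi * d / L := by positivity
    calc _ ≤ (Real.pi * d / L * ‖p‖) ^ n := norm_iteratedFDeriv_planeWave_le hL p n x
      _ ≤ ((1 + Real.pi * d / L) * R) ^ n := by gcongr; linarith
      _ ≤ ((1 + Real.pi * d / L) * R) ^ 2 :=
        pow_le_pow_right₀ (one_le_mul_of_one_le_of_one_le (by linarith) hR) hn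
      _ = _ := mul_pow _ _ _
  have h1 : (fun y => a * (planeWave L k y - planeWave L l y)) =
      a • (planeWave L k - planeWave L l) := rfl
  have hW : ∀ p : Fin d → ℤ, ContDiffAt ℝ n (planeWave L p) x := fun p =>
    (contDiff_planeWave p).contDiffAt
  rw [h1, iteratedFDeriv_const_smul_apply (f := planeWave L k - planeWave L l)
    ((hW k).sub (hW l)), norm_smul,
    iteratedFDeriv_sub_apply (hW k) (hW l)]
  calc ‖a‖ * _ ≤ ‖a‖ * ((1 + Real.pi * d / L) ^ 2 * R ^ 2 + (1 + Real.pi * d / L) ^ 2 * R ^ 2) := by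
        gcongr
        exact (norm_sub_le _ _).trans (add_le_add (hb k hk) (hb l hl))
    _ = _ := by ring

/-- A function in the periodic Sobolev space `H^m`, `m > d/2 + 2`, has a periodic representative
of class `C²`, whose trigonometric interpolants converge with rate `N^{-(m - d/2 - 2)}` together
with their Laplacians. -/
theorem exists_representative_interpolation_error (hd : 1 ≤ d) (hL : 0 < L) {m : ℕ}
    (hm : (d : ℝ) / 2 + 2 < m) {f : Space d → ℂ} (hf : MemPeriodicSobolev L m f) :
    ∃ F : Space d → ℂ, ContDiff ℝ 2 F ∧ IsPeriodic L F ∧ F =ᵐ[volume.restrict (box d L)] f ∧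
      ∃ C : ℝ, 0 ≤ C ∧ ∀ N : ℕ, 0 < N → Even N → ∀ x : Space d,
        ‖F x - interpolant L N F x‖ ≤ C * (N : ℝ) ^ (-((m : ℝ) - (d : ℝ) / 2 - 2)) ∧
        ‖Laplacian.laplacian F x - Laplacian.laplacian (interpolant L N F) x‖ ≤
          C * (N : ℝ) ^ (-((m : ℝ) - (d : ℝ) / 2 - 2)) := by
  set a := boxFourierCoeff L f with ha
  obtain ⟨C, hC0, hC⟩ := exists_tail_weighted_le hm (summable_sobolev_weight hd hL hf)
  have hlt : ∀ k : Fin d → ℤ, k ≠ 0 → (1 : ℝ) ≤ ‖k‖ := fun k hk => by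
    obtain ⟨i, hi⟩ := Function.ne_iff.1 hk
    refine le_trans ?_ (norm_le_pi_norm k i)
    rw [Int.norm_eq_abs]
    exact_mod_cast Int.one_le_abs hi
  have hs : Summable fun k => (1 + ‖k‖) ^ 2 * ‖a k‖ := by
    -- The tail with `M = 1` omits only `k = 0`, and `(1 + ‖k‖)² ≤ 4 ‖k‖²` elsewhere.
    refine ((((hC 1 one_pos).1.mul_left 4).add
      (summable_of_hasFiniteSupport (f := fun k => if k = 0 then ‖a k‖ else 0)
        ((Set.finite_singleton 0).subset fun k hk => by_contra fun h => hk (if_neg h))))).of_nonneg_of_le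
      (fun k => by positivity) fun k => ?_
    by_cases hk : k = 0
    · subst hk
      simp
    · have := hlt k hk
      rw [Nat.cast_one, if_pos this, if_neg hk, add_zero, ← mul_assoc]
      gcongr
      nlinarith
  have hs0 : Summable fun k => ‖a k‖ := hs.of_nonneg_of_le (fun _ => norm_nonneg _) fun k =>
    le_mul_of_one_le_left (norm_nonneg _) (one_le_pow₀ (by linarith [norm_nonneg k]))
  set F : Space d → ℂ := fun x => ∑' k, a k * planeWave L k x with hFdef
  have hF2 : ContDiff ℝ 2 F := by
    refine contDiff_tsum (N := 2) (v := fun _ k => (1 + Real.pi * d / L) ^ 2 * ((1 + ‖k‖) ^ 2 * ‖a k‖))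
      (fun k => contDiff_const.mul (contDiff_planeWave k)) (fun _ _ => hs.mul_left _)
      fun n k x hn => ?_
    have hn2 : n ≤ 2 := by exact_mod_cast hn
    have h1 : (fun y => a k * planeWave L k y) = a k • planeWave L k := rfl
    have hc : 0 ≤ Real.pi * d / L := by positivity
    rw [h1, iteratedFDeriv_const_smul_apply (contDiff_planeWave k).contDiffAt, norm_smul]
    calc _ ≤ ‖a k‖ * (Real.pi * d / L * ‖k‖) ^ n := by
          gcongr; exact norm_iteratedFDeriv_planeWave_le hL k n x
      _ ≤ ‖a k‖ * ((1 + Real.pi * d / L) * (1 + ‖k‖)) ^ n := by gcongr <;> linarith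
      _ ≤ ‖a k‖ * ((1 + Real.pi * d / L) * (1 + ‖k‖)) ^ 2 := by
          gcongr
          exact one_le_mul_of_one_le_of_one_le (by linarith) (by linarith [norm_nonneg k])
      _ = _ := by ring
  refine ⟨F, hF2, fun i x => ?_, tsum_boxFourierCoeff_ae_eq hL hf.1 hs0, ?_⟩
  · simp only [hFdef, planeWave_periodic hL _ i x]
  set K := 2 * (1 + Real.pi * d / L) ^ 2 with hK
  have hK0 : 0 ≤ K := by positivity
  set r := (m : ℝ) - (d : ℝ) / 2 - 2 with hr
  -- `2 ^ r` converts the rate in `M = N / 2` to one in `N`; in `1 + d`, the 1 serves the values and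
  -- `d` the Laplacian.
  refine ⟨(1 + d) * (K * (C * 2 ^ r)), by positivity, fun N hN hNe x => ?_⟩
  obtain ⟨M, rfl⟩ := hNe.two_dvd
  have hM : 0 < M := by omega
  have hM1 : (1 : ℝ) ≤ M := by exact_mod_cast hM
  obtain ⟨hT, hTle⟩ := hC M hM
  set T : (Fin d → ℤ) → ℝ := fun k => if (M : ℝ) ≤ ‖k‖ then ‖k‖ ^ 2 * ‖a k‖ else 0 with hTdef
  set u : (Fin d → ℤ) → Space d → ℂ := fun k y =>
    a k * (planeWave L k y - planeWave L (aliasFrequency M k) y) with hu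
  have hu2 : ∀ k, ContDiff ℝ 2 (u k) := fun k =>
    contDiff_const.mul ((contDiff_planeWave k).sub (contDiff_planeWave _))
  have hub : ∀ n : ℕ, n ≤ 2 → ∀ k y, ‖iteratedFDeriv ℝ n (u k) y‖ ≤ K * T k := by
    intro n hn k y
    by_cases hk : (M : ℝ) ≤ ‖k‖
    · simp only [hTdef, if_pos hk]
      exact norm_iteratedFDeriv_mul_planeWave_sub_le hL (a k) k _ (hM1.trans hk) le_rfl
        ((norm_aliasFrequency_le hM k).trans hk) hn y
    · have : u k = 0 := by
        ext y
        simp [hu, aliasFrequency_of_norm_lt (not_le.1 hk)]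
      simp [this, hTdef, if_neg hk]
  have herr : (fun y => F y - interpolant L (2 * M) F y) = fun y => ∑' k, u k y := by
    ext y
    have h1 : HasSum (fun k => a k * planeWave L k y) (F y) :=
      (Summable.of_norm (by simpa only [norm_mul, norm_planeWave, mul_one] using hs0)).hasSum
    have h2 := h1.sub (hasSum_interpolant hL hM hs0 y)
    rw [← h2.tsum_eq]
    simp only [hu, mul_sub]
  have hbound : ∀ n : ℕ, n ≤ 2 →
      ‖iteratedFDeriv ℝ n (fun y => F y - interpolant L (2 * M) F y) x‖ ≤
        K * (C * 2 ^ r) * ((2 * M : ℕ) : ℝ) ^ (-r) := by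
    intro n hn
    -- The summable majorant `K * T k` permits differentiation under the sum and then bounds the
    -- result.
    rw [herr, iteratedFDeriv_tsum_apply (N := 2) (v := fun _ k => K * T k) hu2
      (fun _ _ => hT.mul_left K)
      (fun n k y hn => hub n (by exact_mod_cast hn) k y) (by exact_mod_cast hn) x]
    refine (tsum_of_norm_bounded (hT.mul_left K).hasSum fun k => hub n hn k x).trans ?_
    rw [tsum_mul_left]
    have h2 : (M : ℝ) ^ (-r) = 2 ^ r * ((2 * M : ℕ) : ℝ) ^ (-r) := by
      push_cast
      rw [Real.mul_rpow (by norm_num) (by positivity), ← mul_assoc, ← Real.rpow_add (by norm_num)]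
      simp
    rw [h2] at hTle
    calc K * _ ≤ K * (C * (2 ^ r * ((2 * M : ℕ) : ℝ) ^ (-r))) := by gcongr
      _ = _ := by ring
  have hpos : 0 ≤ K * (C * 2 ^ r) * ((2 * M : ℕ) : ℝ) ^ (-r) := by positivity
  have hdpos : (0 : ℝ) ≤ d := d.cast_nonneg
  constructor
  · have := hbound 0 (by norm_num)
    rw [norm_iteratedFDeriv_zero] at this
    refine this.trans ?_
    nlinarith [mul_nonneg hdpos hpos]
  · have h1 := (hF2.contDiffAt (x := x)).laplacian_sub
      ((contDiff_interpolant (L := L) (2 * M) F).contDiffAt (x := x))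
    rw [← h1]
    refine (norm_laplacian_le _ x).trans ?_
    have := mul_le_mul_of_nonneg_left (hbound 2 le_rfl) hdpos
    refine this.trans ?_
    nlinarith

end Error

/-! ### Bounds for the two operators -/

section Operators

variable {d : ℕ} {L : ℝ}

theorem continuous_coeffA (βn βs : ℝ) : Continuous (coeffA βn βs) := by
  unfold coeffA density spinVector
  fun_prop

theorem continuous_coeffB (βn βs : ℝ) : Continuous (coeffB βn βs) := by
  unfold coeffB
  fun_prop

/-- A continuous matrix function is bounded along a bounded family of arguments. -/
theorem exists_norm_entry_le {c : (Fin 3 → ℂ) → Matrix (Fin 3) (Fin 3) ℂ} (hc : Continuous c)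
    {Φ : Space d → Fin 3 → ℂ} {s : Set (Space d)} (hΦ : Bornology.IsBounded (Φ '' s)) :
    ∃ R : ℝ, 0 ≤ R ∧ ∀ x ∈ s, ∀ i j, ‖c (Φ x) i j‖ ≤ R := by
  -- Compactness is taken in the space of values, so `Φ` need not be continuous.
  have hK : IsCompact (closure (Φ '' s)) := hΦ.isCompact_closure
  have h : ∀ p : Fin 3 × Fin 3, ∃ R, ∀ φ ∈ closure (Φ '' s), ‖c φ p.1 p.2‖ ≤ R := fun p =>
    hK.exists_bound_of_continuousOn (f := fun φ => c φ p.1 p.2) (by fun_prop)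
  choose R hR using h
  refine ⟨∑ p, |R p|, Finset.sum_nonneg fun _ _ => abs_nonneg _, fun x hx i j => ?_⟩
  refine (hR (i, j) _ (subset_closure ⟨x, hx, rfl⟩)).trans ((le_abs_self _).trans ?_)
  exact Finset.single_le_sum (f := fun p => |R p|) (fun _ _ => abs_nonneg _) (Finset.mem_univ _)

theorem norm_mulVec_apply_le {A : Matrix (Fin 3) (Fin 3) ℂ} {v : Fin 3 → ℂ} {R ε : ℝ} (hR : 0 ≤ R)
    (hA : ∀ i j, ‖A i j‖ ≤ R) (hv : ∀ j, ‖v j‖ ≤ ε) (i : Fin 3) : ‖(A *ᵥ v) i‖ ≤ 3 * R * ε := by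
  rw [Matrix.mulVec, dotProduct]
  refine (norm_sum_le _ _).trans ?_
  refine (Finset.sum_le_sum fun j _ => (norm_mul_le _ _).trans
    (mul_le_mul (hA i j) (hv j) (norm_nonneg _) hR)).trans (le_of_eq ?_)
  simp
  ring

theorem supNorm_le {χ : Space d → Fin 3 → ℂ} {C : ℝ} (h : ∀ j, ∀ x ∈ box d L, ‖χ x j‖ ≤ C) :
    supNorm L χ ≤ ENNReal.ofReal C :=
  iSup_le fun j => iSup₂_le fun x hx => by
    rw [← ofReal_norm]
    exact ENNReal.ofReal_le_ofReal (h j x hx)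

theorem norm_opB_sub_le {βn βs R ε : ℝ} {Φ χ ψ : Space d → Fin 3 → ℂ} {x : Space d} (hR : 0 ≤ R)
    (hA : ∀ i j, ‖coeffB βn βs (Φ x) i j‖ ≤ R) (hε : ∀ j, ‖χ x j - ψ x j‖ ≤ ε) (j : Fin 3) :
    ‖(opB βn βs Φ χ - opB βn βs Φ ψ) x j‖ ≤ 3 * R * ε := by
  simp only [opB, Pi.sub_apply]
  have := norm_mulVec_apply_le hR hA (v := χ x - ψ x) hε j
  rwa [Matrix.mulVec_sub, Pi.sub_apply] at this

theorem norm_opA_sub_le {V : Space d → ℝ} {μ : Fin 3 → ℝ} {βn βs R v ε : ℝ}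
    {Φ χ ψ : Space d → Fin 3 → ℂ} {x : Space d} (hR : 0 ≤ R)
    (hA : ∀ i j, ‖coeffA βn βs (Φ x) i j‖ ≤ R) (hV : |V x| ≤ v) (hε : ∀ j, ‖χ x j - ψ x j‖ ≤ ε)
    (hΔ : ∀ j, ‖Laplacian.laplacian (fun y => χ y j) x -
      Laplacian.laplacian (fun y => ψ y j) x‖ ≤ ε) (j : Fin 3) :
    ‖(opA V μ βn βs Φ χ - opA V μ βn βs Φ ψ) x j‖ ≤ (1 + v + ∑ i, |μ i| + 3 * R) * ε := by
  have hε0 : 0 ≤ ε := (norm_nonneg _).trans (hε j)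
  have hμ : |μ j| ≤ ∑ i, |μ i| :=
    Finset.single_le_sum (f := fun i => |μ i|) (fun _ _ => abs_nonneg _) (Finset.mem_univ j)
  have h1 := norm_mulVec_apply_le hR hA (v := χ x - ψ x) hε j
  rw [Matrix.mulVec_sub, Pi.sub_apply] at h1
  have h2 : (opA V μ βn βs Φ χ - opA V μ βn βs Φ ψ) x j =
      -(1 / 2 : ℂ) * (Laplacian.laplacian (fun y => χ y j) x -
        Laplacian.laplacian (fun y => ψ y j) x) + (V x : ℂ) * (χ x j - ψ x j) -
        (μ j : ℂ) * (χ x j - ψ x j) +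
        ((coeffA βn βs (Φ x) *ᵥ χ x) j - (coeffA βn βs (Φ x) *ᵥ ψ x) j) := by
    simp only [opA, Pi.sub_apply]
    ring
  rw [h2]
  have h3 : ‖-(1 / 2 : ℂ) * (Laplacian.laplacian (fun y => χ y j) x -
      Laplacian.laplacian (fun y => ψ y j) x)‖ ≤ 1 * ε := by
    rw [norm_mul]
    gcongr
    · norm_num
    · exact hΔ j
  have h4 : ‖(V x : ℂ) * (χ x j - ψ x j)‖ ≤ v * ε := by
    rw [norm_mul, Complex.norm_real, Real.norm_eq_abs]
    exact mul_le_mul hV (hε j) (norm_nonneg _) ((abs_nonneg _).trans hV)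
  have h5 : ‖(μ j : ℂ) * (χ x j - ψ x j)‖ ≤ (∑ i, |μ i|) * ε := by
    rw [norm_mul, Complex.norm_real, Real.norm_eq_abs]
    exact mul_le_mul hμ (hε j) (norm_nonneg _) ((abs_nonneg _).trans hμ)
  calc _ ≤ 1 * ε + v * ε + (∑ i, |μ i|) * ε + 3 * R * ε :=
        (norm_add_le _ _).trans (add_le_add ((norm_sub_le _ _).trans
          (add_le_add ((norm_add_le _ _).trans (add_le_add h3 h4)) h5)) h1)
    _ = _ := by ring

end Operators

end SpinBdG

end

theorem mainTheorem7 (d : ℕ) (hd : 1 ≤ d) (hd3 : d ≤ 3) (L : ℝ) (hL : 0 < L)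
    (V : SpinBdG.Space d → ℝ) (hV : Bornology.IsBounded (V '' SpinBdG.box d L))
    (Φ : SpinBdG.Space d → Fin 3 → ℂ) (hΦ : Bornology.IsBounded (Φ '' SpinBdG.box d L))
    (μ : Fin 3 → ℝ) (βn βs : ℝ)
    (m : ℕ) (hm : (d : ℝ) / 2 + 2 < m)
    (χ : SpinBdG.Space d → Fin 3 → ℂ)
    (hχ : ∀ j, SpinBdG.MemPeriodicSobolev L m (fun x => χ x j)) :
    -- `χ'` is the continuous periodic representative of the class of `χ`; it is of class `C²`
    ∃ χ' : SpinBdG.Space d → Fin 3 → ℂ,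
      (∀ j, ContDiff ℝ 2 (fun x => χ' x j) ∧ SpinBdG.IsPeriodic L (fun x => χ' x j)) ∧
      χ' =ᵐ[MeasureTheory.volume.restrict (SpinBdG.box d L)] χ ∧
      ∀ Q : (SpinBdG.Space d → Fin 3 → ℂ) → SpinBdG.Space d → Fin 3 → ℂ,
        Q = SpinBdG.opA V μ βn βs Φ ∨ Q = SpinBdG.opB βn βs Φ →
        ∃ c : ℝ, 0 < c ∧ ∀ N : ℕ, 0 < N → Even N →
          SpinBdG.supNorm L (Q χ' - Q (SpinBdG.vecInterpolant L N χ')) ≤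
            ENNReal.ofReal (c * (N : ℝ) ^ (-((m : ℝ) - (d : ℝ) / 2 - 2))) := by
  choose F hF2 hFp hFae C hC0 hC using fun j =>
    SpinBdG.exists_representative_interpolation_error hd hL hm (hχ j)
  refine ⟨fun x j => F j x, fun j => ⟨hF2 j, hFp j⟩, ?_, ?_⟩
  · filter_upwards [MeasureTheory.ae_all_iff.2 hFae] with x hx
    exact funext hx
  set r := (m : ℝ) - (d : ℝ) / 2 - 2 with hr
  have hS0 : 0 ≤ ∑ j, C j := Finset.sum_nonneg fun j _ => hC0 j
  have hCS : ∀ j, C j ≤ ∑ j, C j := fun j =>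
    Finset.single_le_sum (fun j _ => hC0 j) (Finset.mem_univ j)
  have herr : ∀ N : ℕ, 0 < N → Even N → ∀ x j,
      ‖F j x - SpinBdG.interpolant L N (F j) x‖ ≤ (∑ j, C j) * (N : ℝ) ^ (-r) ∧
      ‖Laplacian.laplacian (F j) x - Laplacian.laplacian (SpinBdG.interpolant L N (F j)) x‖ ≤
        (∑ j, C j) * (N : ℝ) ^ (-r) := fun N hN hNe x j => by
    have hle : C j * (N : ℝ) ^ (-r) ≤ (∑ j, C j) * (N : ℝ) ^ (-r) :=
      mul_le_mul_of_nonneg_right (hCS j) (by positivity)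
    exact ⟨(hC j N hN hNe x).1.trans hle, (hC j N hN hNe x).2.trans hle⟩
  rintro Q (rfl | rfl)
  · obtain ⟨R, hR0, hR⟩ :=
      SpinBdG.exists_norm_entry_le (SpinBdG.continuous_coeffA βn βs) hΦ
    obtain ⟨v, hv⟩ := hV.exists_norm_le
    have hv' : ∀ x ∈ SpinBdG.box d L, |V x| ≤ |v| := fun x hx =>
      (hv _ ⟨x, hx, rfl⟩).trans (le_abs_self v)
    set D := 1 + |v| + ∑ i, |μ i| + 3 * R with hD
    have hD0 : 0 ≤ D := by positivity
    -- The `+ 1` only makes the constant strictly positive.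
    refine ⟨D * ∑ j, C j + 1, by positivity, fun N hN hNe => SpinBdG.supNorm_le fun j x hx => ?_⟩
    have h := SpinBdG.norm_opA_sub_le (μ := μ) (χ := fun x j => F j x)
      (ψ := SpinBdG.vecInterpolant L N fun x j => F j x) hR0 (hR x hx) (hv' x hx)
      (fun j => (herr N hN hNe x j).1) (fun j => (herr N hN hNe x j).2) j
    refine h.trans ?_
    rw [← mul_assoc]
    gcongr
    linarith
  · obtain ⟨R, hR0, hR⟩ :=
      SpinBdG.exists_norm_entry_le (SpinBdG.continuous_coeffB βn βs) hΦ
    refine ⟨3 * R * ∑ j, C j + 1, by positivity, fun N hN hNe =>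
      SpinBdG.supNorm_le fun j x hx => ?_⟩
    have h := SpinBdG.norm_opB_sub_le (χ := fun x j => F j x)
      (ψ := SpinBdG.vecInterpolant L N fun x j => F j x) hR0 (hR x hx)
      (fun j => (herr N hN hNe x j).1) j
    refine h.trans ?_
    rw [← mul_assoc]
    gcongr
    linarith
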